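/- Let $K$ be a field, let $n\ge 2$ and $d\ge 1$ be integers with $\gcd(d,n-1)=1$, and let $$L_n=K\langle x_1,\dots,x_n,y_1,\dots,y_n\rangle\big/\big(x_iy_j-\delta_{ij}\ (1\le i,j\le n),\ \textstyle\sum_{j=1}^n y_jx_j-1\big)$$ be the Leavitt algebra of type $(1,n-1)$ over $K$. Equip $L_n$ with its standard $\mathbb Z$-grading, in which a monomial $y_{i_1}\cdots y_{i_t}x_{j_1}\cdots x_{j_u}$ has degree $u-t$; the homogeneous component of degree $k$ is the $K$-span of the monomials of degree $k$. (1) Let $X_1,\dots,X_n,Y_1,\dots,Y_n\in \mathrm M_d(L_n)$ satisfy $X_iY_j=\delta_{ij}I$ for $1\le i,j\le n$ and $\sum_{j=1}^n Y_jX_j=I$. Suppose that every entry of each $X_i$ lies in the homogeneous component of degree $1$ and every entry of each $Y_i$ lies in the homogeneous component of degree $-1$ (for instance, every entry of $X_i$, respectively of $Y_i$, is $0$ or a monomial of degree $1$, respectively $-1$). If $\{X_1,\dots,X_n,Y_1,\dots,Y_n\}$ generates $\mathrm M_d(L_n)$ as a $K$-algebra, then $d\mid n^\alpha$ for some positive integer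 $\alpha$. (2) In particular, let $X_1,\dots,X_n,Y_1,\dots,Y_n$ be Leavitt's matrices, defined as follows: for $1\le i\le n$ and $1\le j\le d$ write $(i-1)d+(j-1)=(c-1)n+(k-1)$ with $1\le c\le d$ and $1\le k\le n$; the $j$-th row of $X_i$ has $x_k$ in column $c$ and $0$ elsewhere, and $Y_i$ is obtained from the transpose of $X_i$ by replacing each $x_k$ with $y_k$. Then $\{X_1,\dots,X_n,Y_1,\dots,Y_n\}$ generates $\mathrm M_d(L_n)$ as a $K$-algebra if and only if $d\mid n^\alpha$ for some positive integer $\alpha$. -/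

import Mathlib

noncomputable section

namespace Leavitt

/-- The defining relations of the Leavitt algebra, on the free algebra whose generators are
`X_i = ι (Sum.inl i)` and `Y_i = ι (Sum.inr i)`. -/
inductive Rel (K : Type*) [Field K] (n : ℕ) :
    FreeAlgebra K (Fin n ⊕ Fin n) → FreeAlgebra K (Fin n ⊕ Fin n) → Prop
  | x_mul_y (i j : Fin n) :
      Rel K n (FreeAlgebra.ι K (Sum.inl i) * FreeAlgebra.ι K (Sum.inr j)) (if i = j then 1 else 0)
  | sum_y_mul_x :
      Rel K n (∑ j : Fin n, FreeAlgebra.ι K (Sum.inr j) * FreeAlgebra.ι K (Sum.inl j)) 1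

/-- The Leavitt algebra `L_n = L_K(1, n)`: the quotient of the free associative `K`-algebra on
`X_1, …, X_n, Y_1, …, Y_n` by the ideal generated by `X_i Y_j - δ_{ij}` and `∑ j, Y_j X_j - 1`. -/
def LeavittAlgebra (K : Type*) [Field K] (n : ℕ) : Type _ :=
  RingQuot (Rel K n)

instance instRing (K : Type*) [Field K] (n : ℕ) : Ring (LeavittAlgebra K n) :=
  inferInstanceAs (Ring (RingQuot (Rel K n)))

instance instAlgebra (K : Type*) [Field K] (n : ℕ) : Algebra K (LeavittAlgebra K n) :=
  inferInstanceAs (Algebra K (RingQuot (Rel K n)))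

/-- The generator `x_i` of `L_n`. -/
def x (K : Type*) [Field K] {n : ℕ} (i : Fin n) : LeavittAlgebra K n :=
  RingQuot.mkAlgHom K (Rel K n) (FreeAlgebra.ι K (Sum.inl i))

/-- The generator `y_i` of `L_n`. -/
def y (K : Type*) [Field K] {n : ℕ} (i : Fin n) : LeavittAlgebra K n :=
  RingQuot.mkAlgHom K (Rel K n) (FreeAlgebra.ι K (Sum.inr i))

/-- The homogeneous component of degree `k` of the standard `ℤ`-grading of `L_n`: the linear span
of the monomials `y_{i_1} ⋯ y_{i_t} x_{j_1} ⋯ x_{j_u}` with `u - t = k`. -/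
def homogeneousComponent (K : Type*) [Field K] (n : ℕ) (k : ℤ) :
    Submodule K (LeavittAlgebra K n) :=
  Submodule.span K {z | ∃ v w : List (Fin n), (w.length : ℤ) - (v.length : ℤ) = k ∧
    z = (v.map (y K)).prod * (w.map (x K)).prod}

/-- The Leavitt relations `a_i b_j = δ_{ij}` and `∑ j, b_j a_j = 1` for elements
`a_1, …, a_n, b_1, …, b_n` of a ring. -/
def SatisfiesRelations {R : Type*} [Ring R] {n : ℕ} (a b : Fin n → R) : Prop :=
  (∀ i j : Fin n, a i * b j = if i = j then 1 else 0) ∧ ∑ j : Fin n, b j * a j = 1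

/-- Leavitt's matrices `X_1, …, X_n` in `M_d(L_n)`. Counting from `0`, the list
`x_0, …, x_{n-1}` is written `d` times in succession, the `c`-th copy going to column `c`, and the
resulting `n * d` rows are cut into `n` blocks of `d` rows, the `i`-th block being `X_i`. So
row `j` of `X_i` has the single nonzero entry `x_{m % n}`, in column `m / n`, where
`m = i * d + j`. -/
def leavittX (K : Type*) [Field K] (d n : ℕ) (i : Fin n) :
    Matrix (Fin d) (Fin d) (LeavittAlgebra K n) :=
  Matrix.of fun j c =>
    if ((i : ℕ) * d + (j : ℕ)) / n = (c : ℕ) then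
      x K ⟨((i : ℕ) * d + (j : ℕ)) % n, Nat.mod_lt _ i.pos⟩
    else 0

/-- Leavitt's dual matrices `Y_i = X_i^*`, the transpose of `X_i` with each `x_k` replaced
by `y_k`. -/
def leavittY (K : Type*) [Field K] (d n : ℕ) (i : Fin n) :
    Matrix (Fin d) (Fin d) (LeavittAlgebra K n) :=
  Matrix.of fun c j =>
    if ((i : ℕ) * d + (j : ℕ)) / n = (c : ℕ) then
      y K ⟨((i : ℕ) * d + (j : ℕ)) % n, Nat.mod_lt _ i.pos⟩
    else 0

end Leavitt

end

/-! Necessity: if `a`, `b` satisfy the Leavitt relations, the `n ^ t` words of length `t` satisfy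
them too, so the products (word in `b`)(word in `a`) of length `t` are a full system of matrix
units, spanning a copy of `M_{n^t}(K)`. Inserting `∑ r, b r * a r = 1` in the middle shows that
these copies increase with `t`. When the generators are homogeneous of degrees `1` and `-1`, the
degree-zero elements of the algebra they generate are exactly the union of these copies. The
constant matrix units of `M_d(L_n)` have degree zero and are finitely many, so if they are generated
they all lie in one `M_{n^t}(K)`, and `d × d` matrix units there force `d ∣ n ^ t` by a dimension
count (`exists_dvd_pow_of_adjoin_eq_top`).

Sufficiency: words of length `t` in Leavitt's matrices have the same shape as the matrices
themselves, with `n ^ t` in place of `n` (`wordX_leavittX`). If `n ^ t = q * d`, each such word is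
supported in one column, and sums of `q` products give the constant matrix units
(`single_eq_sum_words`). These isolate the entries of the generators, hence everything. -/

noncomputable section

namespace Leavitt

open Finset

/-- The product of the `a`'s along the `t` lowest base-`n` digits of `m`, lowest digit first. -/
def wordX {R : Type*} [Ring R] {n : ℕ} [NeZero n] (a : Fin n → R) : ℕ → ℕ → R
  | 0, _ => 1
  | t + 1, m => a (Fin.ofNat n m) * wordX a t (m / n)

/-- The product of the `b`'s along the `t` lowest base-`n` digits of `m`, lowest digit last. -/
def wordY {R : Type*} [Ring R] {n : ℕ} [NeZero n] (b : Fin n → R) : ℕ → ℕ → R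
  | 0, _ => 1
  | t + 1, m => wordY b t (m / n) * b (Fin.ofNat n m)

theorem sum_fin_sum_fin_eq_sum_range {M : Type*} [AddCommMonoid M] (f : ℕ → M) (n d : ℕ) :
    ∑ i : Fin n, ∑ j : Fin d, f (i * d + j) = ∑ m ∈ range (n * d), f m := by
  induction n with
  | zero => simp
  | succ n ih =>
    rw [Fin.sum_univ_castSucc, add_mul, one_mul, Finset.sum_range_add, ← ih]
    simp [Finset.sum_range]

/-! ### Words of fixed length satisfy the Leavitt relations -/

section Words

variable {R : Type*} [Ring R] {n : ℕ} [NeZero n] {a b : Fin n → R}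

theorem wordX_mul_wordY (h : SatisfiesRelations a b) (t : ℕ) :
    ∀ m m' : ℕ, m < n ^ t → m' < n ^ t →
      wordX a t m * wordY b t m' = if m = m' then 1 else 0 := by
  induction t with
  | zero =>
    intro m m' hm hm'
    rw [if_pos (by simp at hm hm'; omega)]
    simp [wordX, wordY]
  | succ t ih =>
    intro m m' hm hm'
    have hlt : ∀ k, k < n ^ (t + 1) → k / n < n ^ t := fun k hk =>
      Nat.div_lt_of_lt_mul (by rwa [pow_succ'] at hk)
    have : wordX a (t + 1) m * wordY b (t + 1) m' =
        a (Fin.ofNat n m) * (wordX a t (m / n) * wordY b t (m' / n)) * b (Fin.ofNat n m') := by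
      simp only [wordX, wordY, mul_assoc]
    rw [this, ih _ _ (hlt m hm) (hlt m' hm')]
    by_cases hmm : m = m'
    · subst hmm
      simp [h.1]
    · rw [if_neg hmm]
      by_cases hq : m / n = m' / n
      · have hr : Fin.ofNat n m ≠ Fin.ofNat n m' := by
          intro hr
          have hr' : m % n = m' % n := congrArg Fin.val hr
          apply hmm
          rw [← Nat.div_add_mod m n, ← Nat.div_add_mod m' n, hq, hr']
        rw [hq, if_pos rfl, mul_one, h.1, if_neg hr]
      · simp [hq]

theorem ofNat_mul_add (q : ℕ) (r : Fin n) : Fin.ofNat n (q * n + r) = r := by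
  apply Fin.ext
  simp [Fin.ofNat, Nat.mod_eq_of_lt r.isLt]

theorem mul_add_div (q : ℕ) (r : Fin n) : (q * n + r) / n = q := by
  rw [mul_comm, Nat.mul_add_div (NeZero.pos n), Nat.div_eq_of_lt r.isLt, add_zero]

theorem wordX_succ_mul_add (t q : ℕ) (r : Fin n) :
    wordX a (t + 1) (q * n + r) = a r * wordX a t q := by
  rw [wordX, ofNat_mul_add, mul_add_div]

theorem wordY_succ_mul_add (t q : ℕ) (r : Fin n) :
    wordY b (t + 1) (q * n + r) = wordY b t q * b r := by
  rw [wordY, ofNat_mul_add, mul_add_div]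

/-- The new lowest digit is rightmost in `wordY` and leftmost in `wordX`, so inserting `1 = ∑ r, b r
* a r` between the two words refines a matrix unit of level `t` into `n` of level `t + 1`. -/
theorem wordY_mul_wordX_eq_sum (h : SatisfiesRelations a b) (t m m' : ℕ) :
    wordY b t m * wordX a t m' =
      ∑ r : Fin n, wordY b (t + 1) (m * n + r) * wordX a (t + 1) (m' * n + r) := by
  simp only [wordX_succ_mul_add, wordY_succ_mul_add]
  calc _ = wordY b t m * (∑ r, b r * a r) * wordX a t m' := by rw [h.2, mul_one]
    _ = _ := by simp only [Finset.mul_sum, Finset.sum_mul, mul_assoc]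

theorem sum_wordY_mul_wordX (h : SatisfiesRelations a b) (t : ℕ) :
    ∑ m ∈ range (n ^ t), wordY b t m * wordX a t m = 1 := by
  induction t with
  | zero => simp [wordX, wordY]
  | succ t ih =>
    rw [pow_succ, ← sum_fin_sum_fin_eq_sum_range, ← ih, Finset.sum_range]
    exact Finset.sum_congr rfl fun m _ => (wordY_mul_wordX_eq_sum h t m m).symm

theorem satisfiesRelations_word (h : SatisfiesRelations a b) (t : ℕ) :
    SatisfiesRelations (fun m : Fin (n ^ t) => wordX a t m)
      (fun m : Fin (n ^ t) => wordY b t m) := by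
  refine ⟨fun i j => ?_, ?_⟩
  · rw [wordX_mul_wordY h t i j i.isLt j.isLt]
    simp [Fin.ext_iff]
  · rw [← Finset.sum_range (fun m => wordY b t m * wordX a t m)]
    exact sum_wordY_mul_wordX h t

theorem mul_add_lt_pow_succ {n t m : ℕ} (hm : m < n ^ t) (r : Fin n) :
    m * n + r < n ^ (t + 1) := by
  have h1 : (m + 1) * n ≤ n ^ t * n := Nat.mul_le_mul_right n hm
  have h2 := r.isLt
  rw [pow_succ]
  linarith [add_mul m 1 n]

theorem exists_wordX_eq (w : List (Fin n)) :
    ∃ m < n ^ w.length, (w.map a).prod = wordX a w.length m := by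
  induction w with
  | nil => exact ⟨0, by simp, by simp [wordX]⟩
  | cons r w ih =>
    obtain ⟨m, hm, he⟩ := ih
    refine ⟨m * n + r, mul_add_lt_pow_succ hm r, ?_⟩
    rw [List.length_cons, wordX_succ_mul_add, List.map_cons, List.prod_cons, he]

theorem exists_wordY_eq (v : List (Fin n)) :
    ∃ m < n ^ v.length, (v.map b).prod = wordY b v.length m := by
  induction v using List.reverseRecOn with
  | nil => exact ⟨0, by simp, by simp [wordY]⟩
  | append_singleton v r ih =>
    obtain ⟨m, hm, he⟩ := ih
    rw [List.length_append, List.length_singleton]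
    refine ⟨m * n + r, mul_add_lt_pow_succ hm r, ?_⟩
    rw [wordY_succ_mul_add, List.map_append, List.prod_append, he]
    simp

end Words

/-! ### Matrix units and divisibility of dimensions -/

section MatrixUnits

variable {K A : Type*} [Field K] [Ring A] [Algebra K A] {N : ℕ}

/-- The homomorphism from matrices over `K` sending the matrix unit `e_{ij}` to `b_i a_j`, for
`a` and `b` satisfying the Leavitt relations. -/
def matrixHom {a b : Fin N → A} (h : SatisfiesRelations a b) :
    Matrix (Fin N) (Fin N) K →ₐ[K] A :=
  AlgHom.ofLinearMap
    { toFun := fun M => ∑ i, ∑ j, M i j • (b i * a j)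
      map_add' := fun M M' => by simp [add_smul, Finset.sum_add_distrib]
      map_smul' := fun c M => by simp [mul_smul, Finset.smul_sum] }
    (by
      simp only [LinearMap.coe_mk, AddHom.coe_mk, Matrix.one_apply, ite_smul, one_smul, zero_smul,
        Finset.sum_ite_eq, Finset.mem_univ, if_true]
      exact h.2)
    (fun M M' => by
      simp only [LinearMap.coe_mk, AddHom.coe_mk]
      have key : ∀ i j k l, (M i j • (b i * a j)) * (M' k l • (b k * a l)) =
          if j = k then (M i j * M' k l) • (b i * a l) else 0 := by
        intro i j k l
        rw [smul_mul_smul_comm, mul_assoc, ← mul_assoc (a j), h.1]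
        split_ifs <;> simp
      simp only [Finset.sum_mul, Finset.mul_sum, key, Matrix.mul_apply, Finset.sum_smul,
        Finset.sum_ite_eq', Finset.mem_univ, if_true]
      rw [Finset.sum_comm]
      conv_rhs => rw [Finset.sum_comm]
      exact Finset.sum_congr rfl fun _ _ => Finset.sum_comm)

theorem matrixHom_apply {a b : Fin N → A} (h : SatisfiesRelations a b)
    (M : Matrix (Fin N) (Fin N) K) : matrixHom h M = ∑ i, ∑ j, M i j • (b i * a j) := rfl

theorem matrixHom_single {a b : Fin N → A} (h : SatisfiesRelations a b) (i j : Fin N) :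
    matrixHom (K := K) h (Matrix.single i j 1) = b i * a j := by
  rw [matrixHom_apply, Finset.sum_eq_single i, Finset.sum_eq_single j]
  · simp
  · intro j' _ hj
    simp [hj.symm]
  · simp
  · intro i' _ hi
    simp [hi.symm]
  · simp

/-- A nonzero matrix ring over a field is simple; `N = 0` is excluded because it would make `1` an
empty sum. -/
theorem matrixHom_injective [Nontrivial A] {a b : Fin N → A} (h : SatisfiesRelations a b) :
    Function.Injective (matrixHom (K := K) h) := by
  have : Nonempty (Fin N) := by
    by_contra hN
    rw [not_nonempty_iff] at hN
    have := h.2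
    simp at this
  exact (matrixHom (K := K) h).toRingHom.injective

/-- A full system of `d × d` matrix units in the endomorphisms of a finite dimensional space `V`
forces `d ∣ dim V`. -/
theorem dvd_finrank_of_matrixUnits {V : Type*} [AddCommGroup V] [Module K V]
    [FiniteDimensional K V] {d : ℕ} (hd : 1 ≤ d) (e : Fin d → Fin d → Module.End K V)
    (hmul : ∀ i j k l, e i j * e k l = if j = k then e i l else 0) (hone : ∑ i, e i i = 1) :
    d ∣ Module.finrank K V := by
  let o : Fin d := ⟨0, hd⟩
  have happ : ∀ i j k l v, e i j (e k l v) = if j = k then e i l v else 0 := by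
    intro i j k l v
    rw [← Module.End.mul_apply, hmul]
    split_ifs <;> rfl
  have hfix : ∀ w ∈ LinearMap.range (e o o), e o o w = w := by
    rintro w ⟨v, rfl⟩
    simp [happ]
  -- The maps `e o i` identify `V` with `d` copies of the range of `e o o`.
  let F : V →ₗ[K] (Fin d → LinearMap.range (e o o)) :=
    LinearMap.pi fun i => (e o i).codRestrict _ fun v => ⟨e o i v, by simp [happ]⟩
  have hF : Function.Bijective F := by
    constructor
    · rw [injective_iff_map_eq_zero]
      intro v hv
      have h0 : ∀ i, e o i v = 0 := fun i => congrArg Subtype.val (congrFun hv i)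
      have : v = ∑ i, e i i v := by
        rw [← LinearMap.sum_apply, hone, Module.End.one_apply]
      rw [this]
      refine Finset.sum_eq_zero fun i _ => ?_
      have := happ i o o i v
      rw [h0 i, map_zero, if_pos rfl] at this
      exact this.symm
    · intro w
      refine ⟨∑ i, e i o (w i), ?_⟩
      ext i
      change e o i (∑ j, e j o (w j)) = w i
      simp [happ, hfix _ (w i).2]
  rw [(LinearEquiv.ofBijective F hF).finrank_eq, Module.finrank_pi_fintype]
  simp

theorem dvd_of_matrixUnits {d : ℕ} (hd : 1 ≤ d) (e : Fin d → Fin d → Matrix (Fin N) (Fin N) K)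
    (hmul : ∀ i j k l, e i j * e k l = if j = k then e i l else 0) (hone : ∑ i, e i i = 1) :
    d ∣ N := by
  have := dvd_finrank_of_matrixUnits (K := K) (V := Fin N → K) hd
    (fun i j => Matrix.toLinAlgEquiv' (e i j))
    (fun i j k l => by
      rw [← map_mul, hmul]
      split_ifs <;> simp)
    (by rw [← map_sum, hone, map_one])
  simpa using this

end MatrixUnits

/-! ### Universal property and nontriviality of the Leavitt algebra -/

section Structure

variable {K : Type*} [Field K] {n : ℕ}

theorem satisfiesRelations_generators (K : Type*) [Field K] (n : ℕ) :
    SatisfiesRelations (x K : Fin n → LeavittAlgebra K n) (y K) := by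
  refine ⟨fun i j => ?_, ?_⟩
  · have := RingQuot.mkAlgHom_rel K (Rel.x_mul_y (K := K) i j)
    rw [map_mul] at this
    refine this.trans ?_
    split_ifs
    · exact map_one _
    · exact map_zero _
  · have := RingQuot.mkAlgHom_rel K (Rel.sum_y_mul_x (K := K) (n := n))
    rw [map_sum, map_one] at this
    simp only [map_mul] at this
    exact this

/-- The universal property of the Leavitt algebra. -/
def lift {A : Type*} [Ring A] [Algebra K A] {a b : Fin n → A} (h : SatisfiesRelations a b) :
    LeavittAlgebra K n →ₐ[K] A :=
  RingQuot.liftAlgHom K ⟨FreeAlgebra.lift K (Sum.elim a b), by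
    rintro _ _ (⟨i, j⟩ | _)
    · have := h.1 i j
      split_ifs at this ⊢ <;> simpa using this
    · simpa using h.2⟩

theorem lift_x {A : Type*} [Ring A] [Algebra K A] {a b : Fin n → A} (h : SatisfiesRelations a b)
    (i : Fin n) : lift (K := K) h (x K i) = a i := by
  refine (RingQuot.liftAlgHom_mkAlgHom_apply ..).trans ?_
  simp

theorem lift_y {A : Type*} [Ring A] [Algebra K A] {a b : Fin n → A} (h : SatisfiesRelations a b)
    (i : Fin n) : lift (K := K) h (y K i) = b i := by
  refine (RingQuot.liftAlgHom_mkAlgHom_apply ..).trans ?_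
  simp

theorem adjoin_generators (K : Type*) [Field K] (n : ℕ) :
    Algebra.adjoin K (Set.range (x K) ∪ Set.range (y K) : Set (LeavittAlgebra K n)) = ⊤ := by
  have h := congrArg (Subalgebra.map (RingQuot.mkAlgHom K (Rel K n)))
    (FreeAlgebra.adjoin_range_ι K (Fin n ⊕ Fin n))
  rw [AlgHom.map_adjoin, Algebra.map_top,
    (AlgHom.range_eq_top _).2 (RingQuot.mkAlgHom_surjective K (Rel K n)), ← Set.range_comp,
    Sum.range_eq] at h
  exact h

/-- The algebra acts on sequences: `a i` restricts to the residue class of `i` mod `n`, and `b i`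
spreads a sequence over that class, with zero elsewhere. -/
instance instNontrivial [NeZero n] : Nontrivial (LeavittAlgebra K n) := by
  let a : Fin n → Module.End K (ℕ → K) := fun i => LinearMap.funLeft K K fun m => m * n + i
  let b : Fin n → Module.End K (ℕ → K) := fun i =>
    LinearMap.pi fun m => if Fin.ofNat n m = i then LinearMap.proj (m / n) else 0
  have ha : ∀ i f m, a i f m = f (m * n + i) := fun i f m => rfl
  have hb : ∀ i f m, b i f m = if Fin.ofNat n m = i then f (m / n) else 0 := by
    intro i f m
    simp only [b, LinearMap.pi_apply]
    split_ifs <;> rfl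
  have h : SatisfiesRelations a b := by
    refine ⟨fun i j => ?_, ?_⟩
    · refine LinearMap.ext fun f => funext fun m => ?_
      rw [Module.End.mul_apply, ha, hb, ofNat_mul_add, mul_add_div]
      split_ifs <;> rfl
    · refine LinearMap.ext fun f => funext fun m => ?_
      rw [LinearMap.sum_apply, Finset.sum_apply]
      simp only [Module.End.mul_apply, hb, ha]
      rw [Finset.sum_ite_eq, if_pos (Finset.mem_univ _)]
      exact congrArg f (Nat.div_add_mod' m n)
  exact (lift (K := K) h).toRingHom.domain_nontrivial

end Structure

/-! ### The grading, encoded by a coaction -/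

section Grading

theorem single_sum {R M ι : Type*} [Semiring R] (m : M) (s : Finset ι) (f : ι → R) :
    AddMonoidAlgebra.single m (∑ i ∈ s, f i) = ∑ i ∈ s, AddMonoidAlgebra.single m (f i) :=
  map_sum (AddMonoidAlgebra.singleAddHom m) f s

variable {K : Type*} [Field K] {n : ℕ}

theorem satisfiesRelations_single (K : Type*) [Field K] (n : ℕ) :
    SatisfiesRelations
      (fun i : Fin n => (AddMonoidAlgebra.single (1 : ℤ) (x K i) :
        AddMonoidAlgebra (LeavittAlgebra K n) ℤ))
      (fun i => AddMonoidAlgebra.single (-1) (y K i)) := by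
  have h := satisfiesRelations_generators K n
  refine ⟨fun i j => ?_, ?_⟩
  · rw [AddMonoidAlgebra.single_mul_single, h.1]
    split_ifs
    · rw [add_neg_cancel, AddMonoidAlgebra.one_def]
    · exact AddMonoidAlgebra.single_zero _
  · simp only [AddMonoidAlgebra.single_mul_single]
    rw [← single_sum, h.2, neg_add_cancel, AddMonoidAlgebra.one_def]

/-- The coaction `L_n → L_n[ℤ]` of the standard grading. -/
def coaction (K : Type*) [Field K] (n : ℕ) :
    LeavittAlgebra K n →ₐ[K] AddMonoidAlgebra (LeavittAlgebra K n) ℤ :=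
  lift (satisfiesRelations_single K n)

/-- The components enter the proof only through this implication, so their independence need not be
proved separately. -/
theorem coaction_of_mem {k : ℤ} {z : LeavittAlgebra K n} (hz : z ∈ homogeneousComponent K n k) :
    coaction K n z = AddMonoidAlgebra.single k z := by
  induction hz using Submodule.span_induction with
  | mem z hz =>
    obtain ⟨v, w, hk, rfl⟩ := hz
    have hx : ∀ w : List (Fin n), coaction K n (w.map (x K)).prod =
        AddMonoidAlgebra.single (w.length : ℤ) (w.map (x K)).prod := by
      intro w
      induction w with
      | nil => exact map_one _
      | cons i w ih =>
        rw [List.map_cons, List.prod_cons, map_mul, ih, coaction, lift_x,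
          AddMonoidAlgebra.single_mul_single, List.length_cons]
        congr 1
        push_cast
        ring
    have hy : ∀ v : List (Fin n), coaction K n (v.map (y K)).prod =
        AddMonoidAlgebra.single (-(v.length : ℤ)) (v.map (y K)).prod := by
      intro v
      induction v with
      | nil => exact map_one _
      | cons i v ih =>
        rw [List.map_cons, List.prod_cons, map_mul, ih, coaction, lift_y,
          AddMonoidAlgebra.single_mul_single, List.length_cons]
        congr 1
        push_cast
        ring
    rw [map_mul, hx, hy, AddMonoidAlgebra.single_mul_single]
    congr 1
    omega
  | zero => simp
  | add z z' _ _ hz hz' => rw [map_add, hz, hz', AddMonoidAlgebra.single_add]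
  | smul c z _ hz => rw [map_smul, hz, AddMonoidAlgebra.smul_single]

/-- The projection of `M_d(L_n)` onto its component of degree `0`. -/
def degreeZeroPart (K : Type*) [Field K] (d n : ℕ) :
    Matrix (Fin d) (Fin d) (LeavittAlgebra K n) →ₗ[K]
      Matrix (Fin d) (Fin d) (LeavittAlgebra K n) where
  toFun M := M.map fun z => (coaction K n z).coeff 0
  map_add' M M' := by
    ext
    simp
  map_smul' c M := by
    ext
    simp

/-- A matrix is homogeneous of degree `k` if the coaction multiplies its entries by `T ^ k`. -/
def IsHomogeneousMatrix {d : ℕ} (k : ℤ) (M : Matrix (Fin d) (Fin d) (LeavittAlgebra K n)) : Prop :=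
  ∀ i j, coaction K n (M i j) = AddMonoidAlgebra.single k (M i j)

variable {d : ℕ} {M M' : Matrix (Fin d) (Fin d) (LeavittAlgebra K n)} {k k' : ℤ}

theorem isHomogeneousMatrix_zero_one :
    IsHomogeneousMatrix 0 (1 : Matrix (Fin d) (Fin d) (LeavittAlgebra K n)) := by
  intro i j
  rw [Matrix.one_apply]
  split_ifs
  · rw [map_one, AddMonoidAlgebra.one_def]
  · rw [map_zero, AddMonoidAlgebra.single_zero]

theorem isHomogeneousMatrix_single (i j : Fin d) :
    IsHomogeneousMatrix 0 (Matrix.single i j (1 : LeavittAlgebra K n)) := by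
  intro i' j'
  rw [Matrix.single_apply]
  split_ifs
  · rw [map_one, AddMonoidAlgebra.one_def]
  · rw [map_zero, AddMonoidAlgebra.single_zero]

theorem IsHomogeneousMatrix.mul (h : IsHomogeneousMatrix k M) (h' : IsHomogeneousMatrix k' M') :
    IsHomogeneousMatrix (k + k') (M * M') := by
  intro i j
  rw [Matrix.mul_apply, map_sum, single_sum]
  exact Finset.sum_congr rfl fun l _ => by
    rw [map_mul, h, h', AddMonoidAlgebra.single_mul_single]

theorem IsHomogeneousMatrix.degreeZeroPart_eq (h : IsHomogeneousMatrix k M) :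
    degreeZeroPart K d n M = if k = 0 then M else 0 := by
  ext i j
  change (coaction K n (M i j)).coeff 0 = _
  rw [h]
  rw [AddMonoidAlgebra.coeff_single]
  split_ifs with hk
  · rw [hk, Finsupp.single_eq_same]
  · exact Finsupp.single_eq_of_ne' hk

theorem isHomogeneousMatrix_prod {ι : Type*} {A : ι → Matrix (Fin d) (Fin d) (LeavittAlgebra K n)}
    (h : ∀ i, IsHomogeneousMatrix k (A i)) (w : List ι) :
    IsHomogeneousMatrix (w.length * k) (w.map A).prod := by
  induction w with
  | nil => simpa using isHomogeneousMatrix_zero_one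
  | cons i w ih =>
    rw [List.map_cons, List.prod_cons, List.length_cons]
    have := (h i).mul ih
    convert this using 1
    push_cast
    ring

end Grading

/-! ### Normal form of words -/

section NormalForm

variable {K A : Type*} [Field K] [Ring A] [Algebra K A] {n : ℕ} {a b : Fin n → A}

/-- The span is stable under right multiplication by generators: `a i` extends the second word,
while `b i` meets the last `a j` and gives `δ_{ji}`, or extends the first word if there is no `a j`.
-/
theorem adjoin_le_span_words (h : SatisfiesRelations a b) :
    Subalgebra.toSubmodule (Algebra.adjoin K (Set.range a ∪ Set.range b)) ≤
      Submodule.span K {z | ∃ v w : List (Fin n), z = (v.map b).prod * (w.map a).prod} := by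
  rw [Algebra.adjoin_eq_span, Submodule.span_le]
  intro z hz
  induction hz using Submonoid.closure_induction_right with
  | one => exact Submodule.subset_span ⟨[], [], by simp⟩
  | mul_right z _ g hg ih =>
    clear * - h ih hg
    replace ih : z ∈ Submodule.span K _ := ih
    induction ih using Submodule.span_induction with
    | mem z hz =>
      obtain ⟨v, w, rfl⟩ := hz
      obtain ⟨i, rfl⟩ | ⟨i, rfl⟩ := hg
      · exact Submodule.subset_span ⟨v, w ++ [i], by simp [mul_assoc]⟩
      · induction w using List.reverseRecOn with
        | nil => exact Submodule.subset_span ⟨v ++ [i], [], by simp⟩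
        | append_singleton w j _ =>
          have : (v.map b).prod * ((w ++ [j]).map a).prod * b i =
              if j = i then (v.map b).prod * (w.map a).prod else 0 := by
            rw [List.map_append, List.prod_append, List.map_singleton, List.prod_singleton,
              mul_assoc, mul_assoc, h.1]
            split_ifs <;> simp
          rw [this]
          split_ifs
          · exact Submodule.subset_span ⟨v, w, rfl⟩
          · exact Submodule.zero_mem _
    | zero => simp
    | add z z' _ _ hz hz' =>
      rw [add_mul]
      exact Submodule.add_mem _ hz hz'
    | smul c z _ hz =>
      rw [smul_mul_assoc]
      exact Submodule.smul_mem _ c hz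

end NormalForm

/-! ### The increasing chain of matrix algebras `M_{n^t}(K)` -/

section Filtration

variable {K A : Type*} [Field K] [Ring A] [Algebra K A] {n : ℕ} [NeZero n] {a b : Fin n → A}

theorem matrixHom_word_range_mono (h : SatisfiesRelations a b) :
    Monotone fun t => (matrixHom (K := K) (satisfiesRelations_word h t)).range := by
  refine monotone_nat_of_le_succ fun t => ?_
  rintro _ ⟨M, rfl⟩
  change matrixHom (satisfiesRelations_word h t) M ∈ _
  rw [matrixHom_apply]
  refine Subalgebra.sum_mem _ fun i _ => Subalgebra.sum_mem _ fun j _ =>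
    Subalgebra.smul_mem _ ?_ _
  rw [wordY_mul_wordX_eq_sum h]
  exact Subalgebra.sum_mem _ fun r _ =>
    ⟨_, matrixHom_single (satisfiesRelations_word h (t + 1)) ⟨_, mul_add_lt_pow_succ i.isLt r⟩
      ⟨_, mul_add_lt_pow_succ j.isLt r⟩⟩

theorem exists_prod_mul_prod_mem_range (h : SatisfiesRelations a b) (v w : List (Fin n))
    (hvw : v.length = w.length) :
    (v.map b).prod * (w.map a).prod ∈
      (matrixHom (K := K) (satisfiesRelations_word h w.length)).range := by
  obtain ⟨l, hl, hv⟩ := exists_wordY_eq (b := b) v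
  obtain ⟨m, hm, hw⟩ := exists_wordX_eq (a := a) w
  rw [hvw] at hl hv
  rw [hv, hw]
  exact ⟨_, matrixHom_single (satisfiesRelations_word h w.length) ⟨l, hl⟩ ⟨m, hm⟩⟩

end Filtration

/-! ### Necessity of the divisibility -/

section Divisibility

variable {K : Type*} [Field K] {d n : ℕ} [NeZero n]
  {X Y : Fin n → Matrix (Fin d) (Fin d) (LeavittAlgebra K n)}

/-- The projection to degree zero kills a product of words of unequal lengths and fixes one of equal
lengths, which is a matrix unit of some level. Projecting lets the induction run over sums with
inhomogeneous terms. -/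
theorem exists_mem_range_of_mem_adjoin (h : SatisfiesRelations X Y)
    (hX : ∀ i, IsHomogeneousMatrix 1 (X i)) (hY : ∀ i, IsHomogeneousMatrix (-1) (Y i))
    {M : Matrix (Fin d) (Fin d) (LeavittAlgebra K n)}
    (hM : M ∈ Algebra.adjoin K (Set.range X ∪ Set.range Y)) :
    ∃ t, degreeZeroPart K d n M ∈ (matrixHom (K := K) (satisfiesRelations_word h t)).range := by
  have hM' := adjoin_le_span_words h hM
  clear hM
  induction hM' using Submodule.span_induction with
  | mem z hz =>
    obtain ⟨v, w, rfl⟩ := hz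
    refine ⟨w.length, ?_⟩
    rw [((isHomogeneousMatrix_prod hY v).mul (isHomogeneousMatrix_prod hX w)).degreeZeroPart_eq]
    split_ifs with hvw
    · exact exists_prod_mul_prod_mem_range h v w (by omega)
    · exact Subalgebra.zero_mem _
  | zero => exact ⟨0, by rw [map_zero]; exact Subalgebra.zero_mem _⟩
  | add z z' _ _ hz hz' =>
    obtain ⟨t, ht⟩ := hz
    obtain ⟨t', ht'⟩ := hz'
    refine ⟨max t t', ?_⟩
    rw [map_add]
    exact Subalgebra.add_mem _ (matrixHom_word_range_mono h (le_max_left t t') ht)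
      (matrixHom_word_range_mono h (le_max_right t t') ht')
  | smul c z _ hz =>
    obtain ⟨t, ht⟩ := hz
    refine ⟨t, ?_⟩
    rw [map_smul]
    exact Subalgebra.smul_mem _ ht c

/-- Homogeneous generators of `M_d(L_n)` satisfying the Leavitt relations force `d` to divide a
power of `n`. -/
theorem exists_dvd_pow_of_adjoin_eq_top (hd : 1 ≤ d) (h : SatisfiesRelations X Y)
    (hX : ∀ i, IsHomogeneousMatrix 1 (X i)) (hY : ∀ i, IsHomogeneousMatrix (-1) (Y i))
    (htop : Algebra.adjoin K (Set.range X ∪ Set.range Y) = ⊤) :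
    ∃ α : ℕ, 1 ≤ α ∧ d ∣ n ^ α := by
  have : Nonempty (Fin d) := ⟨⟨0, hd⟩⟩
  have hex : ∀ p : Fin d × Fin d, ∃ t, Matrix.single p.1 p.2 (1 : LeavittAlgebra K n) ∈
      (matrixHom (K := K) (satisfiesRelations_word h t)).range := by
    intro p
    obtain ⟨t, ht⟩ := exists_mem_range_of_mem_adjoin h hX hY
      (M := Matrix.single p.1 p.2 1) (by rw [htop]; exact Algebra.mem_top)
    rw [(isHomogeneousMatrix_single p.1 p.2).degreeZeroPart_eq, if_pos rfl] at ht
    exact ⟨t, ht⟩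
  choose τ hτ using hex
  -- Finitely many matrix units lie in a common level of the increasing chain.
  let t := Finset.univ.sup τ
  have hmem : ∀ i j : Fin d, Matrix.single i j (1 : LeavittAlgebra K n) ∈
      (matrixHom (K := K) (satisfiesRelations_word h t)).range := fun i j =>
    matrixHom_word_range_mono h (Finset.le_sup (Finset.mem_univ (i, j))) (hτ (i, j))
  choose e he using hmem
  replace he : ∀ i j, matrixHom (satisfiesRelations_word h t) (e i j) = Matrix.single i j 1 := he
  have hinj := matrixHom_injective (K := K) (satisfiesRelations_word h t)
  have hdvd : d ∣ n ^ t := by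
    refine dvd_of_matrixUnits hd e (fun i j k l => hinj ?_) (hinj ?_)
    · rw [map_mul, he, he]
      split_ifs with hjk
      · rw [hjk, Matrix.single_mul_single_same, he, one_mul]
      · rw [Matrix.single_mul_single_of_ne (h := hjk), map_zero]
    · simp only [map_sum, he, map_one]
      exact Matrix.sum_single_one
  -- The level `t` may be `0`, while the exponent must be positive.
  exact ⟨t + 1, by omega, hdvd.trans (pow_dvd_pow n (Nat.le_succ t))⟩

end Divisibility

/-! ### Leavitt's matrices and sufficiency -/

section LeavittMatrices

variable (K : Type*) [Field K] (d n : ℕ) [NeZero n]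

theorem leavittX_apply (i : Fin n) (j c : Fin d) :
    leavittX K d n i j c =
      if (i * d + j : ℕ) / n = c then x K (Fin.ofNat n (i * d + j)) else 0 := rfl

theorem leavittY_apply (i : Fin n) (j c : Fin d) :
    leavittY K d n i c j =
      if (i * d + j : ℕ) / n = c then y K (Fin.ofNat n (i * d + j)) else 0 := rfl

theorem mul_add_lt_mul {n d : ℕ} (i : Fin n) (j : Fin d) : (i * d + j : ℕ) < n * d := by
  have h1 : ((i : ℕ) + 1) * d ≤ n * d := Nat.mul_le_mul_right d i.isLt
  have h2 := j.isLt
  linarith [add_mul (i : ℕ) 1 d]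

theorem mul_add_inj {d : ℕ} {i i' : ℕ} {j j' : Fin d} (h : i * d + j = i' * d + j') :
    i = i' ∧ j = j' := by
  have : NeZero d := ⟨by have := j.isLt; omega⟩
  have h1 := congrArg (· / d) h
  simp only [mul_add_div] at h1
  subst h1
  exact ⟨rfl, Fin.ext (by omega)⟩

theorem satisfiesRelations_leavitt : SatisfiesRelations (leavittX K d n) (leavittY K d n) := by
  have h := satisfiesRelations_generators K n
  refine ⟨fun i i' => ?_, ?_⟩
  · ext j j'
    rw [Matrix.mul_apply]
    simp only [leavittX_apply, leavittY_apply]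
    have hc : (i * d + j : ℕ) / n < d := Nat.div_lt_of_lt_mul (mul_add_lt_mul i j)
    rw [Finset.sum_eq_single ⟨_, hc⟩]
    · rw [if_pos rfl, mul_ite, mul_zero, h.1]
      by_cases hm : (i * d + j : ℕ) = i' * d + j'
      · obtain ⟨hi, hj⟩ := mul_add_inj hm
        rw [if_pos (congrArg (· / n) hm.symm), if_pos (congrArg _ hm), if_pos (Fin.ext hi), hj, Matrix.one_apply_eq]
      · have hr : (if i = i' then (1 : Matrix (Fin d) (Fin d) (LeavittAlgebra K n)) else 0) j j'
            = 0 := by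
          split_ifs with hi
          · exact Matrix.one_apply_ne fun hj => hm (by rw [hi, hj])
          · rfl
        rw [hr]
        split_ifs with h1 h2
        · refine absurd ?_ hm
          rw [← Nat.div_add_mod (i * d + j) n, ← Nat.div_add_mod (i' * d + j') n, show _ = (i * d + j : ℕ) / n from h1]
          exact congrArg _ (congrArg Fin.val h2)
        · rfl
        · rfl
    · intro c _ hne
      rw [if_neg fun hc' => hne (Fin.ext hc'.symm), zero_mul]
    · simp
  · ext c c'
    rw [Matrix.sum_apply]
    simp only [Matrix.mul_apply, leavittX_apply, leavittY_apply]
    -- The `n` blocks of `d` rows are regrouped as `d` blocks of `n`, one for each column, on which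
    -- `∑ r, y r * x r = 1` applies.
    rw [sum_fin_sum_fin_eq_sum_range fun m =>
      (if m / n = c then y K (Fin.ofNat n m) else 0) *
        (if m / n = c' then x K (Fin.ofNat n m) else 0), mul_comm,
      ← sum_fin_sum_fin_eq_sum_range]
    simp only [mul_add_div, ofNat_mul_add, ← Fin.ext_iff]
    rw [Finset.sum_eq_single c]
    · rw [Matrix.one_apply]
      by_cases hc : c = c'
      · simpa [hc] using h.2
      · simp [hc]
    · intro q _ hq
      simp [hq]
    · simp

theorem leavittX_mem (i : Fin n) (j c : Fin d) :
    leavittX K d n i j c ∈ homogeneousComponent K n 1 := by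
  rw [leavittX_apply]
  split_ifs
  · exact Submodule.subset_span ⟨[], [Fin.ofNat n (i * d + j)], by simp, by simp⟩
  · exact Submodule.zero_mem _

theorem leavittY_mem (i : Fin n) (c j : Fin d) :
    leavittY K d n i c j ∈ homogeneousComponent K n (-1) := by
  rw [leavittY_apply]
  split_ifs
  · exact Submodule.subset_span ⟨[Fin.ofNat n (i * d + j)], [], by simp, by simp⟩
  · exact Submodule.zero_mem _

/-- One step of long multiplication of `I` by `d` in base `n`: with incoming carry `j`, the lowest
digit of `I` produces the carry `(I % n * d + j) / n` for `I / n`. -/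
theorem digit_step (t I j : ℕ) :
    (I * d + j) / n = I / n * d + (I % n * d + j) / n ∧
      (I * d + j) / n ^ (t + 1) = (I * d + j) / n / n ^ t := by
  have hn := NeZero.pos n
  refine ⟨?_, by rw [pow_succ', Nat.div_div_eq_div_mul]⟩
  conv_lhs => rw [← Nat.div_add_mod I n]
  rw [add_mul, add_assoc, mul_assoc, Nat.mul_add_div hn]

theorem ofNat_mod_pow_succ (t m : ℕ) : Fin.ofNat n (m % n ^ (t + 1)) = Fin.ofNat n m :=
  Fin.ext (Nat.mod_mod_of_dvd m (dvd_pow_self n (Nat.succ_ne_zero t)))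

theorem ofNat_digit (I j : ℕ) : Fin.ofNat n (I % n * d + j) = Fin.ofNat n (I * d + j) :=
  Fin.ext (((Nat.mod_modEq I n).mul_right d).add_right j)

/-- Leavitt's matrices perform long multiplication by `d` in base `n`: rows are incoming carries,
columns outgoing ones, and the entry records the digit written. After `t` digits the written part is
`(I * d + j) % n ^ t` and the carry `(I * d + j) / n ^ t`. -/
theorem wordX_leavittX (t : ℕ) : ∀ (I : ℕ) (j c : Fin d), I < n ^ t →
    wordX (leavittX K d n) t I j c =
      if (I * d + j) / n ^ t = c then wordX (x K) t ((I * d + j) % n ^ t) else 0 := by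
  induction t with
  | zero =>
    intro I j c hI
    obtain rfl : I = 0 := by simpa using hI
    simp [wordX, Matrix.one_apply, Fin.ext_iff]
  | succ t ih =>
    intro I j c hI
    obtain ⟨h1, h2⟩ := digit_step d n t I j
    have hlt : I / n < n ^ t := Nat.div_lt_of_lt_mul (by rwa [pow_succ'] at hI)
    have hc : (I % n * d + j) / n < d := Nat.div_lt_of_lt_mul
      (mul_add_lt_mul (⟨I % n, Nat.mod_lt _ (NeZero.pos n)⟩ : Fin n) j)
    rw [wordX, Matrix.mul_apply, Finset.sum_eq_single ⟨_, hc⟩]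
    · rw [ih _ _ _ hlt, leavittX_apply]
      simp only [Fin.val_ofNat]
      rw [if_pos trivial, ← h1, ← h2, wordX, ofNat_mod_pow_succ, ofNat_digit, pow_succ',
        Nat.mod_mul_right_div_self, mul_ite, mul_zero]
    · intro c' _ hne
      rw [leavittX_apply, if_neg fun hc' => hne (Fin.ext hc'.symm), zero_mul]
    · simp

theorem wordY_leavittY (t : ℕ) : ∀ (I : ℕ) (j c : Fin d), I < n ^ t →
    wordY (leavittY K d n) t I c j =
      if (I * d + j) / n ^ t = c then wordY (y K) t ((I * d + j) % n ^ t) else 0 := by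
  induction t with
  | zero =>
    intro I j c hI
    obtain rfl : I = 0 := by simpa using hI
    simp [wordY, Matrix.one_apply, Fin.ext_iff, eq_comm]
  | succ t ih =>
    intro I j c hI
    obtain ⟨h1, h2⟩ := digit_step d n t I j
    have hlt : I / n < n ^ t := Nat.div_lt_of_lt_mul (by rwa [pow_succ'] at hI)
    have hc : (I % n * d + j) / n < d := Nat.div_lt_of_lt_mul
      (mul_add_lt_mul (⟨I % n, Nat.mod_lt _ (NeZero.pos n)⟩ : Fin n) j)
    rw [wordY, Matrix.mul_apply, Finset.sum_eq_single ⟨_, hc⟩]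
    · rw [ih _ _ _ hlt, leavittY_apply]
      simp only [Fin.val_ofNat]
      rw [if_pos trivial, ← h1, ← h2, wordY, ofNat_mod_pow_succ, ofNat_digit, pow_succ',
        Nat.mod_mul_right_div_self, ite_mul, zero_mul]
    · intro c' _ hne
      rw [leavittY_apply, if_neg fun hc' => hne (Fin.ext hc'.symm), mul_zero]
    · simp

/-- When `d q = n ^ t`, the words in Leavitt's matrices produce all the matrix units. -/
theorem single_eq_sum_words {t q : ℕ} (hq : n ^ t = q * d) (c c' : Fin d) :
    Matrix.single c c' (1 : LeavittAlgebra K n) =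
      ∑ I : Fin q, wordY (leavittY K d n) t (c * q + I) * wordX (leavittX K d n) t (c' * q + I) := by
  have hlt : ∀ (c : Fin d) (I : Fin q), (c * q + I : ℕ) < n ^ t := fun c I => by
    rw [hq, mul_comm q]
    exact mul_add_lt_mul c I
  have hpos : 0 < n ^ t := pow_pos (NeZero.pos n) t
  have hI : ∀ (I : Fin q) (j : Fin d), (I * d + j : ℕ) < n ^ t := fun I j => by
    rw [hq]
    exact mul_add_lt_mul I j
  -- As `q * d = n ^ t`, the word with index `c * q + I` has all its rows in column `c`.
  have hdm : ∀ (c : ℕ) (I : Fin q) (j : Fin d), ((c * q + I) * d + j) / n ^ t = c ∧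
      ((c * q + I) * d + j) % n ^ t = I * d + j := fun c I j => by
    have : (c * q + I) * d + j = n ^ t * c + (I * d + j) := by rw [hq]; ring
    rw [this, Nat.mul_add_div hpos, Nat.mul_add_mod, Nat.div_eq_of_lt (hI I j),
      Nat.mod_eq_of_lt (hI I j), add_zero]
    exact ⟨rfl, rfl⟩
  ext r s
  rw [Matrix.sum_apply]
  simp only [Matrix.mul_apply, wordX_leavittX K d n t _ _ _ (hlt _ _),
    wordY_leavittY K d n t _ _ _ (hlt _ _), hdm]
  rw [Matrix.single_apply]
  simp only [← Fin.ext_iff]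
  by_cases hr : c = r
  · by_cases hs : c' = s
    · simp only [hr, hs, if_true, and_self]
      -- The indices `I * d + j` run once through all `n ^ t` words.
      rw [sum_fin_sum_fin_eq_sum_range fun m => wordY (y K) t m * wordX (x K) t m, ← hq]
      exact (sum_wordY_mul_wordX (satisfiesRelations_generators K n) t).symm
    · simp [hs]
  · simp [hr]

theorem adjoin_leavitt_eq_top {t : ℕ} (hdvd : d ∣ n ^ t) :
    Algebra.adjoin K (Set.range (leavittX K d n) ∪ Set.range (leavittY K d n)) = ⊤ := by
  set S := Algebra.adjoin K (Set.range (leavittX K d n) ∪ Set.range (leavittY K d n)) with hS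
  have hX : ∀ i, leavittX K d n i ∈ S := fun i => Algebra.subset_adjoin (Or.inl ⟨i, rfl⟩)
  have hY : ∀ i, leavittY K d n i ∈ S := fun i => Algebra.subset_adjoin (Or.inr ⟨i, rfl⟩)
  have hwX : ∀ s m, wordX (leavittX K d n) s m ∈ S := by
    intro s
    induction s with
    | zero => exact fun _ => S.one_mem
    | succ s ih => exact fun m => S.mul_mem (hX _) (ih _)
  have hwY : ∀ s m, wordY (leavittY K d n) s m ∈ S := by
    intro s
    induction s with
    | zero => exact fun _ => S.one_mem
    | succ s ih => exact fun m => S.mul_mem (ih _) (hY _)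
  obtain ⟨q, hq⟩ := hdvd
  rw [mul_comm] at hq
  have hunit : ∀ c c', Matrix.single c c' (1 : LeavittAlgebra K n) ∈ S := by
    intro c c'
    rw [single_eq_sum_words K d n hq]
    exact S.sum_mem fun I _ => S.mul_mem (hwY _ _) (hwX _ _)
  have hmove : ∀ (M : Matrix (Fin d) (Fin d) (LeavittAlgebra K n)), M ∈ S →
      ∀ i j c c', Matrix.single c c' (M i j) ∈ S := by
    intro M hM i j c c'
    have : Matrix.single c c' (M i j) = Matrix.single c i 1 * M * Matrix.single j c' 1 := by
      rw [Matrix.single_mul_mul_single, one_mul, mul_one]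
    rw [this]
    exact S.mul_mem (S.mul_mem (hunit _ _) hM) (hunit _ _)
  -- Each `x k` occurs in every column `c`: it sits at position `c * n + k` of the list of all rows.
  have hrow : ∀ (c : Fin d) (k : Fin n), ∃ (i : Fin n) (j : Fin d),
      (i * d + j : ℕ) / n = c ∧ Fin.ofNat n (i * d + j) = k := by
    intro c k
    have hd : 0 < d := c.pos
    have hlt := mul_add_lt_mul c k
    refine ⟨⟨(c * n + k) / d, Nat.div_lt_of_lt_mul hlt⟩, ⟨(c * n + k) % d, Nat.mod_lt _ hd⟩, ?_⟩
    rw [Nat.div_add_mod']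
    exact ⟨mul_add_div _ _, ofNat_mul_add _ _⟩
  have hgen : ∀ (z : LeavittAlgebra K n) (c c' : Fin d), Matrix.single c c' z ∈ S := by
    intro z
    have hz : z ∈ Algebra.adjoin K (Set.range (x K) ∪ Set.range (y K)) := by
      rw [adjoin_generators]
      exact Algebra.mem_top
    induction hz using Algebra.adjoin_induction with
    | mem z hz =>
      intro c c'
      obtain ⟨k, rfl⟩ | ⟨k, rfl⟩ := hz
      · obtain ⟨i, j, h1, h2⟩ := hrow c k
        have := hmove _ (hX i) j c c c'
        rwa [leavittX_apply, if_pos h1, h2] at this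
      · obtain ⟨i, j, h1, h2⟩ := hrow c k
        have := hmove _ (hY i) c j c c'
        rwa [leavittY_apply, if_pos h1, h2] at this
    | algebraMap r =>
      intro c c'
      rw [Algebra.algebraMap_eq_smul_one, ← Matrix.smul_single]
      exact S.smul_mem (hunit c c') r
    | add z z' _ _ hz hz' =>
      intro c c'
      rw [Matrix.single_add]
      exact S.add_mem (hz c c') (hz' c c')
    | mul z z' _ _ hz hz' =>
      intro c c'
      rw [← Matrix.single_mul_single_same (j := c)]
      exact S.mul_mem (hz c c) (hz' c c')
  rw [eq_top_iff]
  intro M _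
  rw [Matrix.matrix_eq_sum_single M]
  exact S.sum_mem fun i _ => S.sum_mem fun j _ => hgen _ i j

end LeavittMatrices

end Leavitt

end

theorem corollary5 (K : Type*) [Field K] (n d : ℕ) (hn : 2 ≤ n) (hd : 1 ≤ d)
    (hgcd : Nat.gcd d (n - 1) = 1) :
    (∀ X Y : Fin n → Matrix (Fin d) (Fin d) (Leavitt.LeavittAlgebra K n),
      Leavitt.SatisfiesRelations X Y →
      (∀ i j c, X i j c ∈ Leavitt.homogeneousComponent K n 1) →
      (∀ i j c, Y i j c ∈ Leavitt.homogeneousComponent K n (-1)) →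
      Algebra.adjoin K (Set.range X ∪ Set.range Y) = ⊤ →
      ∃ α : ℕ, 1 ≤ α ∧ d ∣ n ^ α) ∧
    (Algebra.adjoin K (Set.range (Leavitt.leavittX K d n) ∪ Set.range (Leavitt.leavittY K d n)) = ⊤
      ↔ ∃ α : ℕ, 1 ≤ α ∧ d ∣ n ^ α) := by
  have : NeZero n := ⟨by omega⟩
  have part : ∀ X Y : Fin n → Matrix (Fin d) (Fin d) (Leavitt.LeavittAlgebra K n),
      Leavitt.SatisfiesRelations X Y →
      (∀ i j c, X i j c ∈ Leavitt.homogeneousComponent K n 1) →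
      (∀ i j c, Y i j c ∈ Leavitt.homogeneousComponent K n (-1)) →
      Algebra.adjoin K (Set.range X ∪ Set.range Y) = ⊤ →
      ∃ α : ℕ, 1 ≤ α ∧ d ∣ n ^ α := fun X Y h hX hY =>
    Leavitt.exists_dvd_pow_of_adjoin_eq_top hd h
      (fun i j c => Leavitt.coaction_of_mem (hX i j c))
      (fun i j c => Leavitt.coaction_of_mem (hY i j c))
  exact ⟨part, part _ _ (Leavitt.satisfiesRelations_leavitt K d n) (Leavitt.leavittX_mem K d n)
    (Leavitt.leavittY_mem K d n), fun ⟨_, _, h⟩ => Leavitt.adjoin_leavitt_eq_top K d n h⟩
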